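/- **Setting.** A model $\mathcal{D}$ is a set of probability distributions on $\mathbb{R}$ that all admit an expectation; $\mathrm{E}(\zeta)$ is the expectation of $\zeta$ and $\mathrm{KL}$ the Kullback–Leibler divergence. For $\nu \in \mathcal{D}$ and $x \in \mathbb{R}$ let $$\mathcal{L}_{\inf}^{<}(x,\nu)=\inf\{\mathrm{KL}(\zeta,\nu):\zeta\in\mathcal{D},\ \mathrm{E}(\zeta)<x\},\qquad \mathcal{L}_{\inf}^{>}(x,\nu)=\inf\{\mathrm{KL}(\zeta,\nu):\zeta\in\mathcal{D},\ \mathrm{E}(\zeta)>x\},$$ with $\inf\emptyset=+\infty$. Let $K\ge 2$. A ($K$-armed bandit) problem in $\mathcal{D}$ is $\underline{\nu}=(\nu_1,\dots,\nu_K)\in\mathcal{D}^K$, with expectations $\mu_a=\mathrm{E}(\nu_a)$. If it has a unique arm with largest expectation, this arm is denoted by $a^\star(\underline{\nu})$, and $\nu^\star=\nu_{a^\star(\underline{\nu})}$, $\mu^\star=\mathrm{E}(\nu^\star)$. It is generic if $\mu_j\ne\mu_k$ for $j\ne k$. A strategy with budget $T$ picks, at each round $t=1,\dots,T$, an arm $A_t$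 that is a measurable function of $H_{t-1}=(U_0,Y_1,U_1,\dots,Y_{t-1},U_{t-1})$, where the $U_s$ are independent auxiliary randomizations, uniform on $[0,1]$; it then observes a payoff $Y_t$ drawn from $\nu_{A_t}$ independently of the past, and it finally recommends an arm $I_T$ that is a measurable function of $H_T$. A sequence of strategies indexed by the budget $T$ is consistent on $\mathcal{D}$ if $\mathbb{P}_{\underline{\nu}}(I_T\ne a^\star(\underline{\nu}))\to 0$ as $T\to+\infty$ for all generic problems $\underline{\nu}$ in $\mathcal{D}$. **Theorem.** Fix $K\ge 2$ and a model $\mathcal{D}$, and consider a consistent sequence of strategies on $\mathcal{D}$. Suppose that at least one of the following two conditions on ties holds. - (a) $\mathbb{P}_{\underline{\nu}}(I_T\ne a^\star(\underline{\nu}))\to 0$ for all problems $\underline{\nu}$ in $\mathcal{D}$ with a unique optimal arm, generic or not (for $K=2$ this is consistency itself). - (b) For every $\nu\in\mathcal{D}$ and every finite $F\subset\mathbb{R}$, restricting the infimum to the $\zeta$ with $\mathrm{E}(\zeta)\notin F$ changes neither $\mathcal{L}_{\inf}^{>}(x,\nu)$ for $x\ge\mathrm{E}(\nu)$, nor $\mathcal{L}_{\inf}^{<}(x,\nu)$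 for $x\le\mathrm{E}(\nu)$ (as is the case, for instance, for convex models and for canonical one-parameter exponential families). Then, for all generic problems $\underline{\nu}$ in $\mathcal{D}$, with values in $[-\infty,+\infty]$ and $\ln 0=-\infty$, $$\liminf_{T\to+\infty}\frac1T\ln\mathbb{P}_{\underline{\nu}}\bigl(I_T\ne a^\star(\underline{\nu})\bigr)\ \ge\ -\min_{k\ne a^\star(\underline{\nu})}\ \inf_{x\in[\mu_k,\mu^\star]}\ \max\bigl\{\mathcal{L}_{\inf}^{>}(x,\nu_k),\,\mathcal{L}_{\inf}^{<}(x,\nu^\star)\bigr\}.$$ -/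

import Mathlib

open MeasureTheory ProbabilityTheory Filter Topology
open scoped ENNReal unitInterval

noncomputable section

namespace BestArm

/-- Histories: `Hist 0` is the range of `H_0 = U_0`, and
`Hist (t + 1) = Hist t × (ℝ × [0,1])` is the range of `H_{t+1} = (H_t, Y_{t+1}, U_{t+1})`. -/
def Hist : ℕ → Type
  | 0 => I
  | t + 1 => Hist t × (ℝ × I)

instance instMeasurableSpaceHist : ∀ t : ℕ, MeasurableSpace (Hist t)
  | 0 => inferInstanceAs (MeasurableSpace I)
  | t + 1 =>
    letI := instMeasurableSpaceHist t
    inferInstanceAs (MeasurableSpace (Hist t × (ℝ × I)))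

/-- A strategy with `K` arms and budget `T`: a measurable sampling scheme, `sample t` giving the
arm `A_{t+1}` as a function of the history `H_t` (only `t < T` matters), and a measurable
recommendation `I_T` as a function of `H_T`. The auxiliary randomization is in the history. -/
structure Strategy (K T : ℕ) where
  sample : (t : ℕ) → Hist t → Fin K
  measurable_sample : ∀ t, Measurable (sample t)
  recommend : Hist T → Fin K
  measurable_recommend : Measurable recommend

/-- A bandit problem with `K` arms: one payoff distribution for each arm. -/
abbrev Problem (K : ℕ) := Fin K → ProbabilityMeasure ℝ

/-- The Markov kernel that maps an arm `a` to its payoff distribution `ν a`. -/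
def payoff {K : ℕ} (ν : Problem K) : Kernel (Fin K) ℝ :=
  Kernel.ofFunOfCountable fun a => (ν a : Measure ℝ)

instance {K : ℕ} (ν : Problem K) : IsMarkovKernel (payoff ν) :=
  ⟨fun a => inferInstanceAs (IsProbabilityMeasure (ν a : Measure ℝ))⟩

/-- Given the history `H_t`, the payoff `Y_{t+1}` has law `ν_{A_{t+1}}` and the auxiliary
randomization `U_{t+1}` is uniform on `[0,1]`, independent of `Y_{t+1}`. -/
def stepKernel {K T : ℕ} (S : Strategy K T) (ν : Problem K) (t : ℕ) : Kernel (Hist t) (ℝ × I) :=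
  ((payoff ν).comap (S.sample t) (S.measurable_sample t)) ×ₖ
    Kernel.const (Hist t) (volume : Measure I)

/-- The law of the history `H_t` when the strategy `S` is run on the problem `ν`. -/
def histLaw {K T : ℕ} (S : Strategy K T) (ν : Problem K) : (t : ℕ) → Measure (Hist t)
  | 0 => (volume : Measure I)
  | t + 1 => (histLaw S ν t) ⊗ₘ (stepKernel S ν t)

/-- The probability, under the problem `ν`, that the arm recommended by `S` is not `a`. -/
def errorProb {K T : ℕ} (S : Strategy K T) (ν : Problem K) (a : Fin K) : ℝ≥0∞ :=
  histLaw S ν T {h | S.recommend h ≠ a}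

/-- The expectation of a distribution. -/
def mean (ζ : ProbabilityMeasure ℝ) : ℝ := ∫ y, y ∂(ζ : Measure ℝ)

/-- A model: a set of distributions over `ℝ` that all admit an expectation. -/
def IsModel (D : Set (ProbabilityMeasure ℝ)) : Prop :=
  ∀ ζ ∈ D, Integrable (fun y : ℝ => y) (ζ : Measure ℝ)

/-- The arm `a` is the unique optimal arm of the problem `ν`. -/
def IsBestArm {K : ℕ} (ν : Problem K) (a : Fin K) : Prop :=
  ∀ k, k ≠ a → mean (ν k) < mean (ν a)

/-- Generic problems: no two arms have the same expectation. -/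
def Generic {K : ℕ} (ν : Problem K) : Prop :=
  ∀ j k, j ≠ k → mean (ν j) ≠ mean (ν k)

/-- Consistency on `D`: for every generic problem in `D`, the probability of misidentifying the
optimal arm vanishes as the budget grows. -/
def Consistent {K : ℕ} (D : Set (ProbabilityMeasure ℝ)) (S : (T : ℕ) → Strategy K T) : Prop :=
  ∀ ν : Problem K, (∀ a, ν a ∈ D) → Generic ν → ∀ a, IsBestArm ν a →
    Tendsto (fun T => errorProb (S T) ν a) atTop (𝓝 0)

/-- Consistency on all the problems in `D` that have a unique optimal arm, including those in
which suboptimal arms share the same expectation. -/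
def ConsistentUniqueBest {K : ℕ} (D : Set (ProbabilityMeasure ℝ))
    (S : (T : ℕ) → Strategy K T) : Prop :=
  ∀ ν : Problem K, (∀ a, ν a ∈ D) → ∀ a, IsBestArm ν a →
    Tendsto (fun T => errorProb (S T) ν a) atTop (𝓝 0)

/-- `inf {KL(ζ, ν) : ζ ∈ D, E(ζ) < x}`, equal to `∞` when there is no such `ζ`. -/
def LinfLT (D : Set (ProbabilityMeasure ℝ)) (x : ℝ) (ν : ProbabilityMeasure ℝ) : ℝ≥0∞ :=
  ⨅ ζ ∈ {ζ | ζ ∈ D ∧ mean ζ < x}, InformationTheory.klDiv (ζ : Measure ℝ) (ν : Measure ℝ)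

/-- `inf {KL(ζ, ν) : ζ ∈ D, E(ζ) > x}`, equal to `∞` when there is no such `ζ`. -/
def LinfGT (D : Set (ProbabilityMeasure ℝ)) (x : ℝ) (ν : ProbabilityMeasure ℝ) : ℝ≥0∞ :=
  ⨅ ζ ∈ {ζ | ζ ∈ D ∧ x < mean ζ}, InformationTheory.klDiv (ζ : Measure ℝ) (ν : Measure ℝ)

/-- The infima that define `LinfGT` above `E(ν)` and `LinfLT` below `E(ν)` do not change when
finitely many values of the expectation are forbidden. -/
def TiesAvoidable (D : Set (ProbabilityMeasure ℝ)) : Prop :=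
  ∀ ν ∈ D, ∀ F : Finset ℝ,
    (∀ x, mean ν ≤ x → LinfGT {ζ | ζ ∈ D ∧ mean ζ ∉ F} x ν = LinfGT D x ν) ∧
    (∀ x, x ≤ mean ν → LinfLT {ζ | ζ ∈ D ∧ mean ζ ∉ F} x ν = LinfLT D x ν)

end BestArm

end

/-! The proof is a change of measure. Take a problem `lam` in which arm `a`, optimal for `ν`, is no
longer optimal and the strategy finds the new best arm: the event `I_T ≠ a` then has
`lam`-probability tending to 1. By the chain rule, the two history laws are within `T * M` in
divergence if each arm is within `M` (`klDiv_histLaw_le`), so this event has `ν`-probability at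
least about `exp(-T * M)` (`neg_le_liminf_log_errorProb`). To build `lam`, lower arm `a` below a
level `x` and, if needed, raise some arm `k` above `x`. Each arm is sampled at most `T` times in
total with the others, hence a maximum of the two costs and not their sum. Ties are the only
obstacle, and conditions (a) and (b) each remove it. -/

namespace MeasureTheory.Measure

/-- The composition-product with a kernel that has a jointly measurable density. -/
lemma compProd_eq_withDensity {X Y : Type*} [MeasurableSpace X] [MeasurableSpace Y]
    {μ : Measure X} [SFinite μ] {κ η : Kernel X Y} [IsSFiniteKernel κ] [IsSFiniteKernel η]
    {f : X × Y → ℝ≥0∞} (hf : Measurable f)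
    (h : ∀ x, κ x = (η x).withDensity fun y => f (x, y)) :
    μ ⊗ₘ κ = (μ ⊗ₘ η).withDensity f := by
  ext s hs
  rw [compProd_apply hs, withDensity_apply _ hs, ← lintegral_indicator hs,
    lintegral_compProd (hf.indicator hs)]
  refine lintegral_congr fun x => ?_
  rw [h, withDensity_apply _ (measurable_prodMk_left hs),
    ← lintegral_indicator (measurable_prodMk_left hs)]
  rfl

end MeasureTheory.Measure

/-! ### Divergences: densities, restriction, a bound on events -/

namespace InformationTheory

open MeasureTheory

lemma klDiv_withDensity {X : Type*} [MeasurableSpace X] (ν : Measure X) [IsFiniteMeasure ν]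
    {f : X → ℝ≥0∞} (hf : Measurable f) [IsFiniteMeasure (ν.withDensity f)] :
    klDiv (ν.withDensity f) ν = ∫⁻ x, ENNReal.ofReal (klFun (f x).toReal) ∂ν := by
  rw [klDiv_eq_lintegral_klFun_of_ac (withDensity_absolutelyContinuous ν f)]
  refine lintegral_congr_ae ?_
  filter_upwards [Measure.rnDeriv_withDensity ν hf] with x hx
  rw [hx]

/-- The conditional Kullback-Leibler divergence of kernels with a jointly measurable density. -/
lemma klDiv_compProd_right_of_withDensity {X Y : Type*} [MeasurableSpace X] [MeasurableSpace Y]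
    (μ : Measure X) [IsFiniteMeasure μ] {κ η : Kernel X Y} [IsMarkovKernel κ] [IsMarkovKernel η]
    {f : X × Y → ℝ≥0∞} (hf : Measurable f)
    (h : ∀ x, κ x = (η x).withDensity fun y => f (x, y)) :
    klDiv (μ ⊗ₘ κ) (μ ⊗ₘ η) = ∫⁻ x, klDiv (κ x) (η x) ∂μ := by
  have hμ := Measure.compProd_eq_withDensity (μ := μ) hf h
  have : IsFiniteMeasure ((μ ⊗ₘ η).withDensity f) := hμ ▸ inferInstance
  rw [hμ, klDiv_withDensity _ hf, Measure.lintegral_compProd (by fun_prop)]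
  refine lintegral_congr fun x => ?_
  have : IsFiniteMeasure ((η x).withDensity fun y => f (x, y)) := h x ▸ inferInstance
  rw [h, klDiv_withDensity _ (by fun_prop)]

/-- Restriction keeps the density, and the integrand `klFun` is nonnegative. This stands in for data
processing for a single event. -/
lemma klDiv_restrict_le {X : Type*} [MeasurableSpace X] (μ ν : Measure X) [IsFiniteMeasure μ]
    [IsFiniteMeasure ν] {s : Set X} (hs : MeasurableSet s) :
    klDiv (μ.restrict s) (ν.restrict s) ≤ klDiv μ ν := by
  by_cases hμν : μ ≪ ν
  swap; · simp [hμν]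
  have hμ : μ.restrict s = (ν.restrict s).withDensity (μ.rnDeriv ν) := by
    rw [← restrict_withDensity hs, Measure.withDensity_rnDeriv_eq _ _ hμν]
  have : IsFiniteMeasure ((ν.restrict s).withDensity (μ.rnDeriv ν)) := hμ ▸ inferInstance
  rw [hμ, klDiv_withDensity _ (by fun_prop), klDiv_eq_lintegral_klFun_of_ac hμν]
  exact setLIntegral_le_lintegral _ _

/-- If the divergence between two probability measures is finite, an event that has a large
probability for the first cannot have a very small probability for the second. -/
lemma real_mul_neg_log_le {X : Type*} [MeasurableSpace X] (μ ν : Measure X)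
    [IsProbabilityMeasure μ] [IsProbabilityMeasure ν] {s : Set X} (hs : MeasurableSet s) {M : ℝ}
    (hM : 0 ≤ M) (h : klDiv μ ν ≤ ENNReal.ofReal M) (hμs : μ s ≠ 0) :
    ν s ≠ 0 ∧ μ.real s * -Real.log (ν.real s) ≤ M + 1 := by
  have hμν : μ ≪ ν := (klDiv_ne_top_iff.mp (ne_top_of_le_ne_top ENNReal.ofReal_ne_top h)).1
  have hνs : ν s ≠ 0 := fun h0 => hμs (hμν h0)
  refine ⟨hνs, ?_⟩
  have h1 := ((mul_log_le_klDiv (μ.restrict s) (ν.restrict s)).trans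
    (klDiv_restrict_le μ ν hs)).trans h
  rw [ENNReal.ofReal_le_ofReal_iff hM] at h1
  simp only [measureReal_restrict_apply MeasurableSet.univ, Set.univ_inter] at h1
  have hp : 0 < μ.real s := ENNReal.toReal_pos hμs (measure_ne_top _ _)
  have hq : 0 < ν.real s := ENNReal.toReal_pos hνs (measure_ne_top _ _)
  rw [Real.log_div hp.ne' hq.ne'] at h1
  -- With `p = μ s`, this reads `p - p log p ≤ 1`, the source of the `+ 1` in the bound.
  have h2 := klFun_nonneg hp.le
  rw [klFun_apply] at h2
  linarith

end InformationTheory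

/-! ### Laws of histories and change of measure -/

namespace BestArm

open InformationTheory

instance {K T : ℕ} (S : Strategy K T) (ν : Problem K) (t : ℕ) :
    IsMarkovKernel (stepKernel S ν t) := by
  unfold stepKernel; infer_instance

instance {K T : ℕ} (S : Strategy K T) (ν : Problem K) (t : ℕ) :
    IsProbabilityMeasure (histLaw S ν t) := by
  induction t with
  | zero => exact inferInstanceAs (IsProbabilityMeasure (volume : Measure I))
  | succ t ih => exact inferInstanceAs (IsProbabilityMeasure (histLaw S ν t ⊗ₘ stepKernel S ν t))

lemma stepKernel_apply {K T : ℕ} (S : Strategy K T) (ν : Problem K) (t : ℕ) (h : Hist t) :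
    stepKernel S ν t h = (ν (S.sample t h) : Measure ℝ).prod volume := by
  rw [stepKernel, Kernel.prod_apply, Kernel.comap_apply, Kernel.const_apply]
  rfl

lemma klDiv_stepKernel {K T : ℕ} (S : Strategy K T) (lam ν : Problem K) (t : ℕ) (h : Hist t) :
    klDiv (stepKernel S lam t h) (stepKernel S ν t h)
      = klDiv (lam (S.sample t h) : Measure ℝ) (ν (S.sample t h)) := by
  simp only [stepKernel_apply, ← Measure.compProd_const, klDiv_compProd_left]

lemma stepKernel_eq_withDensity {K T : ℕ} (S : Strategy K T) {lam ν : Problem K}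
    (hac : ∀ a, (lam a : Measure ℝ) ≪ ν a) (t : ℕ) (h : Hist t) :
    stepKernel S lam t h = (stepKernel S ν t h).withDensity fun p =>
      (lam (S.sample t h) : Measure ℝ).rnDeriv (ν (S.sample t h)) p.1 := by
  rw [stepKernel_apply, stepKernel_apply, ← prod_withDensity_left (by fun_prop),
    Measure.withDensity_rnDeriv_eq _ _ (hac _)]

/-- There are finitely many arms, so joint measurability can be checked arm by arm. -/
lemma measurable_rnDeriv_sample {K T : ℕ} (S : Strategy K T) (lam ν : Problem K) (t : ℕ) :
    Measurable fun p : Hist t × (ℝ × I) =>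
      (lam (S.sample t p.1) : Measure ℝ).rnDeriv (ν (S.sample t p.1)) p.2.1 := by
  have h : Measurable fun p : Fin K × ℝ => (lam p.1 : Measure ℝ).rnDeriv (ν p.1) p.2 :=
    measurable_from_prod_countable_right fun a =>
      Measure.measurable_rnDeriv (lam a : Measure ℝ) (ν a)
  exact h.comp (((S.measurable_sample t).comp measurable_fst).prodMk
    (measurable_fst.comp measurable_snd))

/-- The divergence between the laws of the histories grows at most linearly. -/
lemma klDiv_histLaw_le {K T : ℕ} (S : Strategy K T) {lam ν : Problem K} {M : ℝ≥0∞}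
    (hac : ∀ a, (lam a : Measure ℝ) ≪ ν a)
    (hM : ∀ a, klDiv (lam a : Measure ℝ) (ν a) ≤ M) (t : ℕ) :
    klDiv (histLaw S lam t) (histLaw S ν t) ≤ t * M := by
  induction t with
  | zero => exact (klDiv_self (volume : Measure I)).trans_le bot_le
  | succ t ih =>
    have h : klDiv (histLaw S lam t ⊗ₘ stepKernel S lam t) (histLaw S lam t ⊗ₘ stepKernel S ν t)
        ≤ M := by
      rw [klDiv_compProd_right_of_withDensity _ (measurable_rnDeriv_sample S lam ν t)
        (stepKernel_eq_withDensity S hac t)]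
      calc _ ≤ ∫⁻ _, M ∂(histLaw S lam t) :=
            lintegral_mono fun h => (klDiv_stepKernel S lam ν t h).trans_le (hM _)
        _ = M := by simp
    calc klDiv (histLaw S lam (t + 1)) (histLaw S ν (t + 1))
        = klDiv (histLaw S lam t) (histLaw S ν t) +
            klDiv (histLaw S lam t ⊗ₘ stepKernel S lam t)
              (histLaw S lam t ⊗ₘ stepKernel S ν t) := klDiv_compProd_eq_add _ _ _ _
      _ ≤ t * M + M := add_le_add ih h
      _ = (t + 1 : ℕ) * M := by push_cast; ring

lemma measurableSet_recommend_ne {K T : ℕ} (S : Strategy K T) (a : Fin K) :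
    MeasurableSet {h | S.recommend h ≠ a} :=
  S.measurable_recommend (MeasurableSet.of_discrete (s := {a}ᶜ))

lemma one_sub_errorProb_le {K T : ℕ} (S : Strategy K T) (ν : Problem K) {a b : Fin K}
    (hab : b ≠ a) : 1 - errorProb S ν b ≤ errorProb S ν a := by
  rw [errorProb, ← prob_compl_eq_one_sub (measurableSet_recommend_ne S b)]
  refine measure_mono fun h hh => ?_
  simp only [Set.mem_compl_iff, Set.mem_ofPred_eq, not_not] at hh
  simpa [hh] using hab

lemma tendsto_errorProb_one {K : ℕ} {S : (T : ℕ) → Strategy K T} {ν : Problem K} {a b : Fin K}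
    (hab : b ≠ a) (h : Tendsto (fun T => errorProb (S T) ν b) atTop (𝓝 0)) :
    Tendsto (fun T => errorProb (S T) ν a) atTop (𝓝 1) := by
  have h1 : Tendsto (fun T => 1 - errorProb (S T) ν b) atTop (𝓝 1) := by
    simpa using ENNReal.Tendsto.sub tendsto_const_nhds h (Or.inl ENNReal.one_ne_top)
  exact tendsto_of_tendsto_of_tendsto_of_le_of_le h1 tendsto_const_nhds
    (fun T => one_sub_errorProb_le (S T) ν hab) fun T => prob_le_one

/-- Change of measure: if the arm `a` is eventually discarded under the problem `lam`, it is
discarded under `ν` with a probability that decreases at most exponentially. -/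
lemma neg_le_liminf_log_errorProb {K : ℕ} {S : (T : ℕ) → Strategy K T} {lam ν : Problem K}
    {a b : Fin K} (hab : b ≠ a) (h : Tendsto (fun T => errorProb (S T) lam b) atTop (𝓝 0))
    {M c : ℝ} (hM0 : 0 ≤ M) (hMc : M < c)
    (hM : ∀ a, klDiv (lam a : Measure ℝ) (ν a) ≤ ENNReal.ofReal M) :
    ((-c : ℝ) : EReal) ≤ liminf (fun T : ℕ => (((1 : ℝ) / (T : ℝ) : ℝ) : EReal) *
      ENNReal.log (errorProb (S T) ν a)) atTop := by
  have hac : ∀ a, (lam a : Measure ℝ) ≪ ν a := fun a =>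
    (klDiv_ne_top_iff.mp (ne_top_of_le_ne_top ENNReal.ofReal_ne_top (hM a))).1
  have hp : Tendsto (fun T => (errorProb (S T) lam a).toReal) atTop (𝓝 1) := by
    simpa [Function.comp_def] using
      (ENNReal.tendsto_toReal ENNReal.one_ne_top).comp (tendsto_errorProb_one hab h)
  -- The exact rate obtained at budget `T`; the gap `M < c` absorbs its distance to `M`.
  have hlim : Tendsto (fun T : ℕ => (M + 1 / (T : ℝ)) / (errorProb (S T) lam a).toReal) atTop
      (𝓝 M) := by
    simpa [Pi.div_def] using
      (tendsto_const_nhds.add tendsto_one_div_atTop_nhds_zero_nat).div hp one_ne_zero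
  refine le_liminf_of_le (by isBoundedDefault) ?_
  filter_upwards [hlim.eventually_lt_const hMc, hp.eventually_const_lt one_pos,
    eventually_gt_atTop 0] with T hT hpos hT0
  have hT0' : (0 : ℝ) < T := by exact_mod_cast hT0
  have hkl : klDiv (histLaw (S T) lam T) (histLaw (S T) ν T) ≤ ENNReal.ofReal (T * M) := by
    rw [ENNReal.ofReal_mul hT0'.le, ENNReal.ofReal_natCast]
    exact klDiv_histLaw_le (S T) hac hM T
  obtain ⟨hν0, hle⟩ := real_mul_neg_log_le _ _ (measurableSet_recommend_ne (S T) a)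
    (by positivity) hkl (ENNReal.toReal_pos_iff.mp hpos).1.ne'
  have hle' : (errorProb (S T) lam a).toReal * -Real.log (errorProb (S T) ν a).toReal
      ≤ T * M + 1 := hle
  have hν0' : 0 < (errorProb (S T) ν a).toReal := ENNReal.toReal_pos hν0 (measure_ne_top _ _)
  rw [← ENNReal.ofReal_toReal (a := errorProb (S T) ν a) (measure_ne_top _ _),
    ENNReal.log_ofReal_of_pos hν0', ← EReal.coe_mul, EReal.coe_le_coe_iff]
  rw [div_lt_iff₀ hpos] at hT
  have h3 : T * M + 1 = T * (M + 1 / T) := by field_simp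
  have h4 : -Real.log (errorProb (S T) ν a).toReal ≤ T * c := by
    by_contra! hcon
    have := mul_lt_mul_of_pos_left hcon hpos
    have := mul_lt_mul_of_pos_left hT hT0'
    nlinarith
  rw [one_div, inv_mul_eq_div, le_div_iff₀ hT0']
  linarith

/-! ### Construction of the alternative problems -/

lemma exists_klDiv_lt_of_LinfGT_lt {D : Set (ProbabilityMeasure ℝ)} {x : ℝ}
    {ν : ProbabilityMeasure ℝ} {c : ℝ≥0∞} (h : LinfGT D x ν < c) :
    ∃ ζ ∈ D, x < mean ζ ∧ klDiv (ζ : Measure ℝ) ν < c := by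
  simp only [LinfGT, iInf_lt_iff] at h
  obtain ⟨ζ, ⟨hD, hx⟩, hc⟩ := h
  exact ⟨ζ, hD, hx, hc⟩

lemma exists_klDiv_lt_of_LinfLT_lt {D : Set (ProbabilityMeasure ℝ)} {x : ℝ}
    {ν : ProbabilityMeasure ℝ} {c : ℝ≥0∞} (h : LinfLT D x ν < c) :
    ∃ ζ ∈ D, mean ζ < x ∧ klDiv (ζ : Measure ℝ) ν < c := by
  simp only [LinfLT, iInf_lt_iff] at h
  obtain ⟨ζ, ⟨hD, hx⟩, hc⟩ := h
  exact ⟨ζ, hD, hx, hc⟩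

/-- The best arm of a problem in which no suboptimal arm ties with the maximum. -/
lemma exists_isBestArm {K : ℕ} [NeZero K] {ν : Problem K}
    (hν : ∀ a b, a ≠ b → (∀ j, mean (ν j) ≤ mean (ν a)) → mean (ν a) ≠ mean (ν b)) :
    ∃ a, IsBestArm ν a := by
  obtain ⟨a, ha⟩ := Finite.exists_max fun a => mean (ν a)
  exact ⟨a, fun k hk => lt_of_le_of_ne (ha k) (hν a k hk.symm ha).symm⟩

/-- If ties between suboptimal arms are harmless, there is a problem close to `ν` in which an arm
other than `a` is eventually recommended. It changes the arm `a` only, unless no other arm has a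
mean above `x`. -/
lemma exists_alternative_of_consistentUniqueBest {K : ℕ} {D : Set (ProbabilityMeasure ℝ)}
    {S : (T : ℕ) → Strategy K T} (hS : ConsistentUniqueBest D S) {ν : Problem K}
    (hνD : ∀ a, ν a ∈ D) (hν : Generic ν) {a k : Fin K} (hk : k ≠ a) {x : ℝ} {c : ℝ≥0∞}
    (hc : 0 < c) (hGT : LinfGT D x (ν k) < c) (hLT : LinfLT D x (ν a) < c) :
    ∃ lam : Problem K, (∀ j, klDiv (lam j : Measure ℝ) (ν j) < c) ∧
      ∃ b, b ≠ a ∧ Tendsto (fun T => errorProb (S T) lam b) atTop (𝓝 0) := by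
  obtain ⟨ζ, hζD, hζx, hζc⟩ := exists_klDiv_lt_of_LinfGT_lt hGT
  obtain ⟨ξ, hξD, hξx, hξc⟩ := exists_klDiv_lt_of_LinfLT_lt hLT
  -- Raising `k` as well could tie `ζ` with the best remaining arm. If some arm already exceeds `x`,
  -- lowering `a` suffices: the maximum is attained among unchanged arms, which have distinct means.
  -- Otherwise `ζ` beats every other arm.
  by_cases hj : ∃ j, j ≠ a ∧ x < mean (ν j)
  · obtain ⟨j, hja, hjx⟩ := hj
    have : NeZero K := ⟨fun h => (h ▸ a).elim0⟩
    have hne : ∀ i, i ≠ a → Function.update ν a ξ i = ν i := fun i hi =>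
      Function.update_of_ne hi _ _
    have hlt : mean (Function.update ν a ξ a) < mean (Function.update ν a ξ j) := by
      rw [Function.update_self, hne j hja]
      exact hξx.trans hjx
    obtain ⟨b, hb⟩ := exists_isBestArm (ν := Function.update ν a ξ) fun i l hil hmax => by
      have hia : i ≠ a := fun h => absurd (hmax j) (by rw [h]; exact hlt.not_ge)
      by_cases hla : l = a
      · rw [hla]
        exact (hlt.trans_le (hmax j)).ne'
      · rw [hne i hia, hne l hla]
        exact hν i l hil
    refine ⟨Function.update ν a ξ, fun i => ?_, b, ?_, hS _ (fun i => ?_) b hb⟩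
    · by_cases hi : i = a
      · subst hi; simpa using hξc
      · simpa [hne i hi] using hc
    · rintro rfl
      exact (hb j hja).not_gt hlt
    · by_cases hi : i = a
      · subst hi; simpa using hξD
      · simpa [hne i hi] using hνD i
  · push Not at hj
    have hlk : Function.update (Function.update ν a ξ) k ζ k = ζ := Function.update_self _ _ _
    have hla : Function.update (Function.update ν a ξ) k ζ a = ξ := by
      rw [Function.update_of_ne hk.symm, Function.update_self]
    have hne : ∀ i, i ≠ k → i ≠ a → Function.update (Function.update ν a ξ) k ζ i = ν i :=
      fun i hi hi' => by rw [Function.update_of_ne hi, Function.update_of_ne hi']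
    refine ⟨Function.update (Function.update ν a ξ) k ζ, fun i => ?_, k, hk,
      hS _ (fun i => ?_) k fun i hik => ?_⟩
    · by_cases hik : i = k
      · subst hik; rwa [hlk]
      · by_cases hia : i = a
        · subst hia; rwa [hla]
        · simpa [hne i hik hia] using hc
    · by_cases hik : i = k
      · subst hik; rwa [hlk]
      · by_cases hia : i = a
        · subst hia; rwa [hla]
        · rw [hne i hik hia]; exact hνD i
    · rw [hlk]
      by_cases hia : i = a
      · subst hia; rw [hla]; exact hξx.trans hζx
      · rw [hne i hik hia]; exact (hj i hia).trans_lt hζx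

/-- If ties can be avoided, there is a generic problem close to `ν` in which an arm other than `a`
is eventually recommended. -/
lemma exists_alternative_of_tiesAvoidable {K : ℕ} {D : Set (ProbabilityMeasure ℝ)}
    {S : (T : ℕ) → Strategy K T} (hS : Consistent D S) (hD : TiesAvoidable D) {ν : Problem K}
    (hνD : ∀ a, ν a ∈ D) (hν : Generic ν) {a k : Fin K} (hk : k ≠ a) {x : ℝ} {c : ℝ≥0∞}
    (hx : x ∈ Set.Icc (mean (ν k)) (mean (ν a)))
    (hc : 0 < c) (hGT : LinfGT D x (ν k) < c) (hLT : LinfLT D x (ν a) < c) :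
    ∃ lam : Problem K, (∀ j, klDiv (lam j : Measure ℝ) (ν j) < c) ∧
      ∃ b, b ≠ a ∧ Tendsto (fun T => errorProb (S T) lam b) atTop (𝓝 0) := by
  -- Avoiding these values prevents ties with unchanged arms; `x` separates `ξ` from `ζ`. Arm `k`
  -- then beats `a`, whichever arm is best.
  set F : Finset ℝ := Finset.univ.image fun j => mean (ν j)
  have hF : ∀ j, mean (ν j) ∈ F := fun j => Finset.mem_image_of_mem _ (Finset.mem_univ j)
  rw [← (hD _ (hνD k) F).1 x hx.1] at hGT
  rw [← (hD _ (hνD a) F).2 x hx.2] at hLT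
  obtain ⟨ζ, ⟨hζD, hζF⟩, hζx, hζc⟩ := exists_klDiv_lt_of_LinfGT_lt hGT
  obtain ⟨ξ, ⟨hξD, hξF⟩, hξx, hξc⟩ := exists_klDiv_lt_of_LinfLT_lt hLT
  have hζν : ∀ j, mean ζ ≠ mean (ν j) := fun j h => hζF (h ▸ hF j)
  have hξν : ∀ j, mean ξ ≠ mean (ν j) := fun j h => hξF (h ▸ hF j)
  have hξζ : mean ξ < mean ζ := hξx.trans hζx
  have : NeZero K := ⟨fun h => (h ▸ a).elim0⟩
  set lam : Problem K := Function.update (Function.update ν a ξ) k ζ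
  have hlk : lam k = ζ := Function.update_self _ _ _
  have hla : lam a = ξ := by
    simp only [lam]; rw [Function.update_of_ne hk.symm, Function.update_self]
  have hne : ∀ i, i ≠ k → i ≠ a → lam i = ν i :=
    fun i hi hi' => by simp only [lam]; rw [Function.update_of_ne hi, Function.update_of_ne hi']
  have hcases : ∀ i, i = k ∨ i = a ∨ (i ≠ k ∧ i ≠ a) := fun i => by tauto
  have hgen : Generic lam := by
    intro i j hij
    rcases hcases i with rfl | rfl | ⟨hi, hi'⟩ <;> rcases hcases j with rfl | rfl | ⟨hj, hj'⟩
    · exact absurd rfl hij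
    · rw [hlk, hla]; exact hξζ.ne'
    · rw [hlk, hne j hj hj']; exact hζν j
    · rw [hlk, hla]; exact hξζ.ne
    · exact absurd rfl hij
    · rw [hla, hne j hj hj']; exact hξν j
    · rw [hlk, hne i hi hi']; exact (hζν i).symm
    · rw [hla, hne i hi hi']; exact (hξν i).symm
    · rw [hne i hi hi', hne j hj hj']; exact hν i j hij
  obtain ⟨b, hb⟩ := exists_isBestArm fun i j hij _ => hgen i j hij
  refine ⟨lam, fun i => ?_, b, ?_, hS lam (fun i => ?_) hgen b hb⟩
  · rcases hcases i with rfl | rfl | ⟨hi, hi'⟩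
    · rwa [hlk]
    · rwa [hla]
    · simpa [hne i hi hi'] using hc
  · rintro rfl
    have := hb k hk
    rw [hlk, hla] at this
    exact this.not_gt hξζ
  · rcases hcases i with rfl | rfl | ⟨hi, hi'⟩
    · rwa [hlk]
    · rwa [hla]
    · rw [hne i hi hi']; exact hνD i

end BestArm

theorem theorem4 (K : ℕ) (hK : 2 ≤ K)
    (D : Set (ProbabilityMeasure ℝ)) (hD : BestArm.IsModel D)
    (S : (T : ℕ) → BestArm.Strategy K T) (hS : BestArm.Consistent D S)
    (hties : BestArm.ConsistentUniqueBest D S ∨ BestArm.TiesAvoidable D)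
    (ν : BestArm.Problem K) (hνD : ∀ a, ν a ∈ D) (hν : BestArm.Generic ν)
    (aStar : Fin K) (hbest : BestArm.IsBestArm ν aStar) :
    -((⨅ k ∈ {k : Fin K | k ≠ aStar},
        ⨅ x ∈ Set.Icc (BestArm.mean (ν k)) (BestArm.mean (ν aStar)),
          max (BestArm.LinfGT D x (ν k)) (BestArm.LinfLT D x (ν aStar)) : ℝ≥0∞) : EReal)
      ≤ liminf (fun T : ℕ => (((1 : ℝ) / (T : ℝ) : ℝ) : EReal) *
          ENNReal.log (BestArm.errorProb (S T) ν aStar)) atTop := by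
  rw [EReal.neg_le]
  -- Only real `c` above the infimum matter, so an infinite infimum needs no separate case.
  refine EReal.le_of_forall_lt_iff_le.mp fun c hc => ?_
  rw [← EReal.neg_le, ← EReal.coe_neg]
  have hc0 : 0 ≤ c := by
    exact_mod_cast (EReal.coe_ennreal_nonneg _).trans hc.le
  rw [← max_eq_left hc0, ← EReal.coe_ennreal_ofReal, EReal.coe_ennreal_lt_coe_ennreal_iff] at hc
  obtain ⟨M, hM, hMc⟩ := ENNReal.lt_iff_exists_nnreal_btwn.mp hc
  simp only [iInf_lt_iff, max_lt_iff] at hM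
  obtain ⟨k, hk, x, hx, hGT, hLT⟩ := hM
  -- Unchanged arms have divergence 0, which must be strictly below `M`.
  have hM0 : (0 : ℝ≥0∞) < M := bot_le.trans_lt hGT
  obtain ⟨lam, hlam, b, hb, hlim⟩ : ∃ lam : BestArm.Problem K,
      (∀ j, InformationTheory.klDiv (lam j : Measure ℝ) (ν j) < M) ∧
      ∃ b, b ≠ aStar ∧ Tendsto (fun T => BestArm.errorProb (S T) lam b) atTop (𝓝 0) := by
    rcases hties with h | h
    · exact BestArm.exists_alternative_of_consistentUniqueBest h hνD hν hk hM0 hGT hLT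
    · exact BestArm.exists_alternative_of_tiesAvoidable hS h hνD hν hk hx hM0 hGT hLT
  refine BestArm.neg_le_liminf_log_errorProb hb hlim (M := M) M.2 ?_ fun j => ?_
  · rw [← ENNReal.ofReal_coe_nnreal] at hMc
    exact (ENNReal.ofReal_lt_ofReal_iff_of_nonneg M.2).mp hMc
  · rw [ENNReal.ofReal_coe_nnreal]; exact (hlam j).le
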